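/- Let $\gamma,k,\tau>0$ and let $N_p,d,N_\tau$ be non-negative integers. For each particle $p=1,\dots,N_p$ let $(\boldsymbol X^{(p)},\boldsymbol U^{(p)})$ be a solution on $[0,\infty)$, with continuous velocity paths in $\mathbb R^d$, of the Langevin equations $$d\boldsymbol X=\boldsymbol U\,dt,\qquad d\boldsymbol U=-\gamma\boldsymbol U\,dt+\gamma\sqrt{2k}\,d\boldsymbol W,$$ where $\boldsymbol W=\boldsymbol W^{(p)}$ is a $d$-dimensional Brownian motion (a vector of $d$ independent standard real Brownian motions). Assume that the initial velocity has the stationary law, $\boldsymbol U^{(p)}(0)\sim\mathcal N(\boldsymbol 0,k\gamma\,\mathbb I)$, and is independent of $\boldsymbol W^{(p)}$, and that the particles are independent, i.e. the pairs $(\boldsymbol U^{(p)}(0),\boldsymbol W^{(p)})$, $p=1,\dots,N_p$, are independent. Let $\Delta X^{(p)}_{n,i}=X^{(p)}_i((n+1)\tau)-X^{(p)}_i(n\tau)$ for $0\le n\le N_\tau-1$ and $1\le i\le d$. Put $\varphi(x)=(1-e^{-x})/x$ and let $S$ be the $N_\tau\times N_\tau$ symmetric Toeplitz matrix with entries, for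 $m=|i-j|$, $$S_{ij}=\begin{cases}2k\tau\,(1-\varphi(\gamma\tau)) & \text{if } m=0,\\ k\gamma\tau^2\varphi(\gamma\tau)^2e^{-(m-1)\gamma\tau} & \text{if } m>0.\end{cases}$$ Then the vectors $(\Delta X^{(p)}_{0,i},\dots,\Delta X^{(p)}_{N_\tau-1,i})^{\mathrm T}$, for $1\le p\le N_p$ and $1\le i\le d$, are independent, and each of them has the Gaussian law $\mathcal N(\boldsymbol 0,S)$. The matrix $S$ is positive definite, and the collection $\Delta\mathcal X_\tau$ of all the increments has the joint probability density, with respect to Lebesgue measure, $$p(\Delta\mathcal X_\tau\mid\gamma,k)=\prod_{p=1}^{N_p}\prod_{i=1}^{d}\rho_{\mathcal N}\big((\Delta X^{(p)}_{0,i},\dots,\Delta X^{(p)}_{N_\tau-1,i})^{\mathrm T};\boldsymbol 0,S\big),$$ where $\rho_{\mathcal N}(\boldsymbol x;\boldsymbol\mu,C)=\big((2\pi)^{n}\det C\big)^{-1/2}\exp\!\big(-\tfrac12(\boldsymbol x-\boldsymbol\mu)^{\mathrm T}C^{-1}(\boldsymbol x-\boldsymbol\mu)\big)$ is the density at $\boldsymbol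 x\in\mathbb R^n$ of the Gaussian law $\mathcal N(\boldsymbol\mu,C)$. -/

import Mathlib

open MeasureTheory ProbabilityTheory
open scoped NNReal Matrix

noncomputable section

namespace LangevinModel

/-- A `d`-dimensional Brownian motion: a stochastic process whose coordinates are independent
standard real Brownian motions (independent as processes, that is, as random paths). -/
structure IsBrownianVector {Ω : Type*} [MeasurableSpace Ω] {d : ℕ}
    (W : ℝ≥0 → Ω → EuclideanSpace ℝ (Fin d)) (P : Measure Ω) : Prop where
  measurable : ∀ t, Measurable (W t)
  isBrownian : ∀ i : Fin d, IsBrownianReal (fun t ω => W t ω i) P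
  indep : iIndepFun (fun (i : Fin d) (ω : Ω) (t : ℝ≥0) => W t ω i) P

/-- `(X, U)` is a solution, driven by the Brownian motion `W`, of the Langevin equations
`dX = U dt`, `dU = -γ U dt + γ √(2k) dW`. The noise is additive with a constant coefficient and
`W` starts at `0`, so the stochastic integral of that coefficient over `[0, t]` is
`γ √(2k) W t`. The integral form of the equations holds almost surely, simultaneously at all
times, and the velocity has almost surely continuous paths. -/
structure IsLangevinSolution {Ω : Type*} [MeasurableSpace Ω] {d : ℕ} (γ k : ℝ)
    (X U W : ℝ≥0 → Ω → EuclideanSpace ℝ (Fin d)) (P : Measure Ω) : Prop where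
  measurable_position : ∀ t, Measurable (X t)
  measurable_velocity : ∀ t, Measurable (U t)
  continuous_velocity : ∀ᵐ ω ∂P, Continuous (fun t => U t ω)
  position_eq : ∀ᵐ ω ∂P, ∀ t : ℝ≥0,
    X t ω = X 0 ω + ∫ s in (0 : ℝ)..t, U s.toNNReal ω
  velocity_eq : ∀ᵐ ω ∂P, ∀ t : ℝ≥0,
    U t ω = U 0 ω - γ • (∫ s in (0 : ℝ)..t, U s.toNNReal ω) + (γ * √(2 * k)) • W t ω

/-- The `i`-th coordinate of the `n`-th position increment `X ((n+1) τ) - X (n τ)`. -/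
def increment {Ω : Type*} {d : ℕ} (X : ℝ≥0 → Ω → EuclideanSpace ℝ (Fin d)) (τ : ℝ≥0)
    (i : Fin d) (n : ℕ) (ω : Ω) : ℝ :=
  (X (((n : ℝ≥0) + 1) * τ) ω - X ((n : ℝ≥0) * τ) ω) i

/-- `φ(x) = (1 - e^{-x}) / x`. -/
def phi (x : ℝ) : ℝ := (1 - Real.exp (-x)) / x

/-- The covariance of two increments at lag `m`. -/
def lagCov (γ k τ : ℝ) (m : ℕ) : ℝ :=
  if m = 0 then 2 * k * τ * (1 - phi (γ * τ))
  else k * γ * τ ^ 2 * phi (γ * τ) ^ 2 * Real.exp (-((m : ℝ) - 1) * (γ * τ))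

/-- The symmetric Toeplitz matrix `S` whose entry at `(i, j)` depends on the lag `m = |i - j|`. -/
def covMatrix (γ k τ : ℝ) (N : ℕ) : Matrix (Fin N) (Fin N) ℝ :=
  Matrix.of fun i j => lagCov γ k τ ((i : ℤ) - (j : ℤ)).natAbs

/-- The density `ρ(x; μ, C)` at `x` of the `n`-dimensional Gaussian distribution `N(μ, C)`,
for a positive definite matrix `C`. -/
def gaussianDensity {n : ℕ} (x μ : Fin n → ℝ) (C : Matrix (Fin n) (Fin n) ℝ) : ℝ :=
  (√((2 * Real.pi) ^ n * C.det))⁻¹ * Real.exp (-(1 / 2) * ((x - μ) ⬝ᵥ (C⁻¹ *ᵥ (x - μ))))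

end LangevinModel

end

/-! The Langevin equation is linear with additive noise, so it can be solved path by path. Variation
of constants followed by integration by parts writes the `n`-th increment of one coordinate as
`r_n(0) U(0) + c ∫ r_n dW` over `[0, Nτ]`. Here `c = γ√(2k)`, and `r_n = incrResponse γ τ n` is the
displacement during step `n` due to a unit velocity kick at time `s`. Since `r_n` is deterministic,
the integral is an almost sure limit of Riemann–Stieltjes sums (`tendsto_incrApprox`), and no
stochastic integral has to be built.

These sums are linear in the initial velocity and in Brownian increments, hence centred Gaussian.
Their covariances are Riemann sums tending to `kγ r_i(0) r_j(0) + 2kγ² ∫ r_i r_j`, and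
characteristic functions carry the Gaussian law to the limit
(`hasLaw_multivariateGaussian_of_tendsto`). Evaluating the integral gives the Toeplitz entries
(`lagCov_eq_of_le`). The same formula makes the quadratic form of `S` a weighted sum of `f(0)²` and
`∫ f²` with `f = ∑ v_n r_n`, whence positive definiteness (`covMatrix_posDef`).

Independence holds because every increment vector is almost surely one fixed measurable function of
the scalar data `(U_i(0), W_i)`, and these data are independent over particles and coordinates. The
joint density is then a product of Gaussian densities. -/

open Filter Topology

/-! ### Densities of product and image measures -/

namespace MeasureTheory

/-- Tonelli's theorem for a product of functions of separate coordinates. -/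
theorem lintegral_fin_prod_eq_prod {n : ℕ} {E : Fin n → Type*} [∀ i, MeasurableSpace (E i)]
    (μ : ∀ i, Measure (E i)) [∀ i, SigmaFinite (μ i)] {f : ∀ i, E i → ENNReal}
    (hf : ∀ i, Measurable (f i)) :
    ∫⁻ x, ∏ i, f i (x i) ∂(Measure.pi μ) = ∏ i, ∫⁻ x, f i x ∂(μ i) := by
  induction n with
  | zero => simp
  | succ n ih =>
    rw [← (measurePreserving_piFinSuccAbove μ 0).symm.lintegral_comp (by fun_prop)]
    simp_rw [MeasurableEquiv.piFinSuccAbove_symm_apply, Fin.insertNthEquiv,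
      Fin.prod_univ_succ, Fin.insertNth_zero]
    simp only [Fin.zero_succAbove]
    have h := lintegral_prod_mul (μ := μ 0) (ν := Measure.pi fun i : Fin n => μ i.succ)
      (f := f 0) (g := fun y => ∏ i : Fin n, f i.succ (y i)) (hf 0).aemeasurable
      (Finset.measurable_prod _ fun i _ =>
        (hf i.succ).comp (measurable_pi_apply i)).aemeasurable
    rw [ih _ (fun i => hf i.succ)] at h
    exact h

/-- A finite product of measures with densities has the product density. -/
theorem pi_withDensity {n : ℕ} {E : Fin n → Type*} [∀ i, MeasurableSpace (E i)]
    (μ : ∀ i, Measure (E i)) [∀ i, SigmaFinite (μ i)] {f : ∀ i, E i → ENNReal}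
    (hf : ∀ i, Measurable (f i)) [∀ i, SigmaFinite ((μ i).withDensity (f i))] :
    Measure.pi (fun i => (μ i).withDensity (f i)) =
      (Measure.pi μ).withDensity fun x => ∏ i, f i (x i) := by
  refine Measure.pi_eq fun s hs => ?_
  rw [withDensity_apply _ (MeasurableSet.univ_pi hs), ← lintegral_indicator (.univ_pi hs)]
  simp_rw [withDensity_apply _ (hs _), ← lintegral_indicator (hs _)]
  rw [← lintegral_fin_prod_eq_prod μ fun i => (hf i).indicator (hs i)]
  refine lintegral_congr fun x => ?_
  classical
  by_cases hx : x ∈ Set.univ.pi s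
  · rw [Set.indicator_of_mem hx]
    exact Finset.prod_congr rfl fun i _ => (Set.indicator_of_mem (hx i trivial) _).symm
  · rw [Set.indicator_of_notMem hx]
    simp only [Set.mem_pi, not_forall] at hx
    obtain ⟨i, _, hi⟩ := hx
    exact (Finset.prod_eq_zero (Finset.mem_univ i) (Set.indicator_of_notMem hi _)).symm

/-- The image of a measure with density under a measurable equivalence. -/
theorem map_withDensity_equiv {α β : Type*} [MeasurableSpace α] [MeasurableSpace β]
    (e : α ≃ᵐ β) (μ : Measure α) (f : α → ENNReal) :
    (μ.withDensity f).map e = (μ.map e).withDensity (f ∘ e.symm) := by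
  ext s hs
  rw [e.map_apply, withDensity_apply _ (e.measurable hs), withDensity_apply _ hs,
    e.restrict_map, lintegral_map_equiv]
  simp

end MeasureTheory

/-! ### The density of a nondegenerate Gaussian vector -/

namespace LangevinModel

theorem measurable_gaussianDensity {n : ℕ} (μ : Fin n → ℝ) (C : Matrix (Fin n) (Fin n) ℝ) :
    Measurable fun x : Fin n → ℝ => gaussianDensity x μ C := by
  have : Continuous fun x : Fin n → ℝ => gaussianDensity x μ C := by
    unfold gaussianDensity
    simp only [Matrix.mulVec, dotProduct]
    fun_prop
  exact this.measurable

theorem gaussianDensity_nonneg {n : ℕ} (x μ : Fin n → ℝ) (C : Matrix (Fin n) (Fin n) ℝ) :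
    0 ≤ gaussianDensity x μ C := by
  unfold gaussianDensity; positivity

theorem pi_gaussianReal_eq_withDensity (n : ℕ) :
    Measure.pi (fun _ : Fin n => gaussianReal 0 1) =
      (volume : Measure (Fin n → ℝ)).withDensity fun x =>
        ENNReal.ofReal ((√((2 * Real.pi) ^ n))⁻¹ * Real.exp (-(1 / 2) * (x ⬝ᵥ x))) := by
  simp_rw [gaussianReal_of_var_ne_zero 0 one_ne_zero]
  have : SigmaFinite ((volume : Measure ℝ).withDensity (gaussianPDF 0 1)) := by
    rw [← gaussianReal_of_var_ne_zero 0 one_ne_zero]; infer_instance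
  rw [pi_withDensity (n := n) (E := fun _ => ℝ) (fun _ => volume) (f := fun _ => gaussianPDF 0 1)
    (fun _ => measurable_gaussianPDF 0 1), ← volume_pi]
  congr 1
  ext x
  simp only [gaussianPDF, gaussianPDFReal]
  rw [← ENNReal.ofReal_prod_of_nonneg fun i _ => by positivity, Finset.prod_mul_distrib,
    ← Real.exp_sum]
  congr 2
  · have h : √((2 * Real.pi) ^ n) = √(2 * Real.pi) ^ n := by
      rw [Real.sqrt_eq_iff_eq_sq (by positivity) (by positivity), ← pow_mul, mul_comm n, pow_mul,
        Real.sq_sqrt (by positivity)]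
    rw [h]
    simp only [NNReal.coe_one, mul_one, Finset.prod_const, Finset.card_univ, Fintype.card_fin,
      inv_pow]
  · congr 1
    simp only [dotProduct, Finset.mul_sum]
    refine Finset.sum_congr rfl fun i _ => ?_
    simp; ring

-- The Gaussian law is the image of the standard one under the symmetric root `A` of `S`, so this is
-- a linear change of variables: the Jacobian gives `|det A|⁻¹ = (det S)^(-1/2)`, and `|A⁻¹x|² =
-- xᵀS⁻¹x`.
open scoped MatrixOrder in
theorem map_ofLp_multivariateGaussian {n : ℕ} {S : Matrix (Fin n) (Fin n) ℝ} (hS : S.PosDef) :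
    (multivariateGaussian 0 S).map WithLp.ofLp =
      (volume : Measure (Fin n → ℝ)).withDensity fun x =>
        ENNReal.ofReal (gaussianDensity x 0 S) := by
  set A := CFC.sqrt S with hA
  have hAA : A * A = S := CFC.sqrt_mul_sqrt_self _ hS.posSemidef.nonneg
  have hAsymm : Aᵀ = A := by
    have := (CFC.sqrt_nonneg S).isSelfAdjoint
    simpa [IsSelfAdjoint, Matrix.star_eq_conjTranspose] using this
  have hdet : A.det * A.det = S.det := by rw [← Matrix.det_mul, hAA]
  have hSdet : 0 < S.det := hS.det_pos
  have hAdet : A.det ≠ 0 := fun h => by rw [h] at hdet; simp at hdet; exact hSdet.ne hdet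
  have hu : IsUnit A.det := isUnit_iff_ne_zero.2 hAdet
  let e : (Fin n → ℝ) ≃ᵐ (Fin n → ℝ) :=
    { toFun := fun x => A *ᵥ x
      invFun := fun x => A⁻¹ *ᵥ x
      left_inv := fun x => by simp [Matrix.nonsing_inv_mul _ hu]
      right_inv := fun x => by simp [Matrix.mul_nonsing_inv _ hu]
      measurable_toFun := (continuous_const.matrix_mulVec continuous_id).measurable
      measurable_invFun := (continuous_const.matrix_mulVec continuous_id).measurable }
  have he : ∀ x, e x = A *ᵥ x := fun x => rfl
  have hes : ∀ x, e.symm x = A⁻¹ *ᵥ x := fun x => rfl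
  have hmap : (volume : Measure (Fin n → ℝ)).map e = ENNReal.ofReal |A.det⁻¹| • volume := by
    rw [← Real.map_matrix_volume_pi_eq_smul_volume_pi hAdet]
    congr 1
  rw [multivariateGaussian, Measure.map_map (by fun_prop) (by fun_prop),
    ← map_pi_eq_stdGaussian, Measure.map_map (by fun_prop) (by fun_prop)]
  have hcomp : (WithLp.ofLp ∘ fun x : EuclideanSpace ℝ (Fin n) =>
      0 + (Matrix.toEuclideanCLM (𝕜 := ℝ) A) x) ∘ WithLp.toLp 2 = e := by
    ext x i
    simp [he]
  rw [hcomp, pi_gaussianReal_eq_withDensity, map_withDensity_equiv, hmap,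
    withDensity_smul_measure, ← withDensity_smul _ (by
      refine Measurable.comp ?_ e.symm.measurable
      refine ENNReal.measurable_ofReal.comp (Continuous.measurable ?_)
      simp only [dotProduct]; fun_prop)]
  congr 1
  ext x
  simp only [Pi.smul_apply, smul_eq_mul, Function.comp_apply, hes]
  rw [← ENNReal.ofReal_mul (abs_nonneg _)]
  congr 1
  unfold gaussianDensity
  have hq : (A⁻¹ *ᵥ x) ⬝ᵥ (A⁻¹ *ᵥ x) = x ⬝ᵥ (S⁻¹ *ᵥ x) := by
    rw [← hAA, Matrix.mul_inv_rev, ← Matrix.mulVec_mulVec, Matrix.dotProduct_mulVec x,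
      ← Matrix.mulVec_transpose, Matrix.transpose_nonsing_inv, hAsymm]
  rw [hq, sub_zero, ← mul_assoc, ← hdet, Real.sqrt_mul (by positivity), Real.sqrt_mul_self_eq_abs,
    abs_inv, mul_inv, mul_comm |A.det|⁻¹]

end LangevinModel

/-! ### Limits of Gaussian vectors, and independence of pairs -/

namespace ProbabilityTheory

/-- An almost sure limit of centred Gaussian vectors whose covariances converge to a positive
semidefinite matrix `S` has the law `N(0, S)`. -/
theorem hasLaw_multivariateGaussian_of_tendsto {Ω ι : Type*} [MeasurableSpace Ω] [Fintype ι]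
    [DecidableEq ι] {P : Measure Ω} [IsProbabilityMeasure P] {Z : ℕ → ι → Ω → ℝ}
    {Y : ι → Ω → ℝ} {S : Matrix ι ι ℝ} (hS : S.PosSemidef)
    (hZ : ∀ m, HasGaussianLaw (fun ω i => Z m i ω) P) (hmean : ∀ m i, ∫ ω, Z m i ω ∂P = 0)
    (hcov : ∀ i j, Tendsto (fun m => cov[Z m i, Z m j; P]) atTop (𝓝 (S i j)))
    (hlim : ∀ᵐ ω ∂P, ∀ i, Tendsto (fun m => Z m i ω) atTop (𝓝 (Y i ω))) :
    HasLaw (fun ω => WithLp.toLp 2 fun i => Y i ω) (multivariateGaussian 0 S) P := by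
  have hZm : ∀ m i, AEMeasurable (Z m i) P := fun m i => ((hZ m).eval i).aemeasurable
  have hYm : ∀ i, AEMeasurable (Y i) P := fun i =>
    aemeasurable_of_tendsto_metrizable_ae' (fun m => hZm m i) (hlim.mono fun ω h => h i)
  have hY : AEMeasurable (fun ω => WithLp.toLp 2 fun i => Y i ω) P :=
    (WithLp.measurable_toLp 2 _).comp_aemeasurable (aemeasurable_pi_lambda _ hYm)
  have hZ' : ∀ m, HasGaussianLaw (fun ω => WithLp.toLp 2 fun i => Z m i ω) P :=
    fun m => (hZ m).toLp_pi 2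
  refine ⟨hY, ?_⟩
  have := Measure.isProbabilityMeasure_map hY
  apply Measure.ext_of_charFun
  ext t
  rw [charFun_multivariateGaussian hS, charFun_apply,
    integral_map hY (Measurable.aestronglyMeasurable (by fun_prop))]
  -- The characteristic functions of `Z m` have two limits, which must agree: by dominated
  -- convergence that of `Y`, and by the explicit Gaussian formula (`h2`, `h3`) that of `N(0, S)`.
  have h1 : Tendsto (fun m => charFun (P.map fun ω => WithLp.toLp 2 fun i => Z m i ω) t) atTop
      (𝓝 (∫ ω, Complex.exp ((inner ℝ (WithLp.toLp 2 fun i => Y i ω) t : ℝ) * Complex.I) ∂P)) := by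
    simp_rw [charFun_apply]
    have : ∀ m, ∫ x, Complex.exp ((inner ℝ x t : ℝ) * Complex.I)
        ∂(P.map fun ω => WithLp.toLp 2 fun i => Z m i ω) =
        ∫ ω, Complex.exp ((inner ℝ (WithLp.toLp 2 fun i => Z m i ω) t : ℝ) * Complex.I) ∂P :=
      fun m => integral_map (hZ' m).aemeasurable (Measurable.aestronglyMeasurable (by fun_prop))
    simp_rw [this]
    refine tendsto_integral_of_dominated_convergence (fun _ => 1) (fun m => ?_)
      (integrable_const _) (fun m => ?_) ?_
    · have h := (hZ' m).aemeasurable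
      exact (Measurable.comp_aemeasurable (g := fun x : EuclideanSpace ℝ ι =>
        Complex.exp ((inner ℝ x t : ℝ) * Complex.I)) (by fun_prop) h).aestronglyMeasurable
    · exact ae_of_all _ fun ω => by rw [Complex.norm_exp_ofReal_mul_I]
    · filter_upwards [hlim] with ω h
      have hc : Continuous fun x : EuclideanSpace ℝ ι =>
        Complex.exp ((inner ℝ x t : ℝ) * Complex.I) := by fun_prop
      refine (hc.tendsto _).comp ?_
      exact ((PiLp.continuous_toLp 2 _).tendsto _).comp (tendsto_pi_nhds.2 h)
  have h2 : ∀ m, charFun (P.map fun ω => WithLp.toLp 2 fun i => Z m i ω) t =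
      Complex.exp (-((∑ i, ∑ j, t i * (t j * cov[Z m i, Z m j; P]) : ℝ) : ℂ) / 2) := by
    intro m
    have hin : ∀ ω, inner ℝ t (WithLp.toLp 2 fun i => Z m i ω) = ∑ i, t i * Z m i ω := by
      intro ω
      simp [PiLp.inner_apply, mul_comm]
    have hL : ∀ i, MemLp (fun ω => t i * Z m i ω) 2 P :=
      fun i => ((hZ m).eval i).memLp_two.const_mul _
    rw [(hZ' m).charFun_map_eq]
    simp_rw [hin]
    rw [integral_finsetSum _ fun i _ => (hL i).integrable (by norm_num),
      ← covariance_self (Finset.aemeasurable_fun_sum _ fun i _ => (hZm m i).const_mul _),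
      covariance_fun_sum_fun_sum hL hL]
    simp_rw [integral_const_mul, hmean, covariance_const_mul_left, covariance_const_mul_right]
    simp [neg_div]
  have h3 : Tendsto (fun m => charFun (P.map fun ω => WithLp.toLp 2 fun i => Z m i ω) t) atTop
      (𝓝 (Complex.exp (-((∑ i, ∑ j, t i * (t j * S i j) : ℝ) : ℂ) / 2))) := by
    simp_rw [h2]
    refine (Complex.continuous_exp.tendsto _).comp ?_
    refine Tendsto.div_const (Tendsto.neg ?_) _
    refine (Complex.continuous_ofReal.tendsto _).comp ?_
    exact tendsto_finsetSum _ fun i _ => tendsto_finsetSum _ fun j _ =>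
      ((hcov i j).const_mul _).const_mul _
  rw [tendsto_nhds_unique h1 h3]
  congr 1
  simp only [inner_zero_right, Complex.ofReal_zero, zero_mul, zero_sub, neg_div, dotProduct,
    Matrix.mulVec, Finset.mul_sum]
  simp only [mul_comm (S _ _)]

/-- Pairing two independent families of independent variables. -/
theorem iIndepFun.prodMk_of_indepFun {Ω ι α β : Type*} [MeasurableSpace Ω] [Fintype ι]
    [MeasurableSpace α] [MeasurableSpace β] {P : Measure Ω} [IsProbabilityMeasure P]
    {X : ι → Ω → α} {Y : ι → Ω → β} (hXm : ∀ i, Measurable (X i)) (hYm : ∀ i, Measurable (Y i))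
    (hX : iIndepFun X P) (hY : iIndepFun Y P)
    (hXY : IndepFun (fun ω i => X i ω) (fun ω i => Y i ω) P) :
    iIndepFun (fun i ω => (X i ω, Y i ω)) P := by
  have lX : ∀ i, HasLaw (X i) (P.map (X i)) P := fun i => ⟨(hXm i).aemeasurable, rfl⟩
  have lY : ∀ i, HasLaw (Y i) (P.map (Y i)) P := fun i => ⟨(hYm i).aemeasurable, rfl⟩
  have pX : ∀ i, IsProbabilityMeasure (P.map (X i)) := fun i =>
    Measure.isProbabilityMeasure_map (hXm i).aemeasurable
  have pY : ∀ i, IsProbabilityMeasure (P.map (Y i)) := fun i =>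
    Measure.isProbabilityMeasure_map (hYm i).aemeasurable
  have hlaw : ∀ i, HasLaw (fun ω => (X i ω, Y i ω)) ((P.map (X i)).prod (P.map (Y i))) P :=
    fun i => (indepFun_iff_hasLaw_prodMk_prod (lX i) (lY i)).1
      (hXY.comp (measurable_pi_apply i) (measurable_pi_apply i))
  -- Independence becomes a statement on joint laws: the law of the two families is a product of two
  -- product measures, which regroups into a product over `i` of pair laws.
  rw [iIndepFun_iff_hasLaw_pi_pi hlaw]
  have h := (indepFun_iff_hasLaw_prodMk_prod (hX.hasLaw_pi lX) (hY.hasLaw_pi lY)).1 hXY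
  exact (measurePreserving_arrowProdEquivProdArrow α β ι (fun i => P.map (X i))
    (fun i => P.map (Y i))).symm.comp_hasLaw h

end ProbabilityTheory

/-! ### Deterministic calculus: Riemann–Stieltjes sums and variation of constants -/

/-- Convergence of Riemann–Stieltjes sums along uniform partitions of `[0, T]`, for a continuous
integrand and an integrator with a bounded density `q`. -/
theorem tendsto_riemannStieltjes_sum {T C : ℝ} (hT : 0 ≤ T) {w q F : ℝ → ℝ}
    (hw : Continuous w) (hq : ∀ a b, IntervalIntegrable q volume a b) (hC : ∀ s, |q s| ≤ C)
    (hF : ∀ a b, a ≤ b → F b - F a = ∫ s in a..b, q s) {ξ : ℕ → ℕ → ℝ}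
    (hξ : ∀ m k : ℕ, ξ m k ∈ Set.Icc ((k : ℝ) * (T / m)) (((k + 1 : ℕ) : ℝ) * (T / m))) :
    Tendsto (fun m : ℕ => ∑ k ∈ Finset.range m,
        w (ξ m k) * (F (((k + 1 : ℕ) : ℝ) * (T / m)) - F ((k : ℝ) * (T / m))))
      atTop (𝓝 (∫ s in (0 : ℝ)..T, w s * q s)) := by
  have hC0 : 0 ≤ C := (abs_nonneg _).trans (hC 0)
  rw [Metric.tendsto_atTop]
  intro ε hε
  -- With this tolerance the errors of the cells add up to at most `ε * (C T / (C T + 1)) < ε`; the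
  -- `+ 1` covers the case `C T = 0`.
  obtain ⟨δ, hδ, hwδ⟩ := Metric.uniformContinuousOn_iff.1
    (isCompact_Icc.uniformContinuousOn_of_continuous (s := Set.Icc 0 T) hw.continuousOn)
    (ε / (C * T + 1)) (by positivity)
  obtain ⟨M, hM⟩ := exists_nat_gt (T / δ)
  refine ⟨M + 1, fun m hm => ?_⟩
  have hm0 : (0 : ℝ) < m := by exact_mod_cast (by omega : 0 < m)
  have hTm : T / m < δ := by
    rw [div_lt_iff₀ hm0]
    rw [div_lt_iff₀ hδ] at hM
    have : (M : ℝ) ≤ m := by exact_mod_cast (by omega : M ≤ m)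
    nlinarith
  have hTm0 : 0 ≤ T / m := by positivity
  set a : ℕ → ℝ := fun k => (k : ℝ) * (T / m) with ha
  have hmono : ∀ k, a k ≤ a (k + 1) := fun k => by
    simp only [ha]; push_cast; nlinarith
  have hstep : ∀ k, a (k + 1) - a k = T / m := fun k => by
    simp only [ha]; push_cast; ring
  have hwq : ∀ b c, IntervalIntegrable (fun s => w s * q s) volume b c := fun b c =>
    (hq b c).continuousOn_mul hw.continuousOn
  have hsum : ∫ s in (0 : ℝ)..T, w s * q s =
      ∑ k ∈ Finset.range m, ∫ s in a k..a (k + 1), w s * q s := by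
    rw [intervalIntegral.sum_integral_adjacent_intervals fun k _ => hwq _ _]
    congr 1
    · simp [ha]
    · simp only [ha]; field_simp
  have hterm : ∀ k ∈ Finset.range m,
      |w (ξ m k) * (F (a (k + 1)) - F (a k)) - ∫ s in a k..a (k + 1), w s * q s| ≤
        ε / (C * T + 1) * C * (T / m) := by
    intro k hk
    have hk' : k + 1 ≤ m := Finset.mem_range.1 hk
    have hak : 0 ≤ a k := by simp only [ha]; positivity
    have hak1 : a (k + 1) ≤ T := by
      have h1 : ((k + 1 : ℕ) : ℝ) ≤ m := by exact_mod_cast hk'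
      calc a (k + 1) ≤ m * (T / m) := mul_le_mul_of_nonneg_right h1 hTm0
        _ = T := by field_simp
    rw [hF _ _ (hmono k), ← intervalIntegral.integral_const_mul,
      ← intervalIntegral.integral_sub ((hq _ _).const_mul _) (hwq _ _), ← hstep k,
      ← Real.norm_eq_abs, ← abs_of_nonneg (sub_nonneg.2 (hmono k))]
    refine intervalIntegral.norm_integral_le_of_norm_le_const fun s hs => ?_
    rw [Set.uIoc_of_le (hmono k)] at hs
    have hξk := hξ m k
    rw [← sub_mul, norm_mul]
    refine mul_le_mul ?_ (hC s) (norm_nonneg _) (by positivity)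
    rw [← dist_eq_norm]
    refine (hwδ _ ⟨hak.trans hξk.1, hξk.2.trans hak1⟩ _
      ⟨hak.trans hs.1.le, hs.2.trans hak1⟩ ?_).le
    rw [Real.dist_eq, abs_lt]
    have h2 := hstep k
    have h3 : a k ≤ ξ m k := hξk.1
    have h4 : ξ m k ≤ a (k + 1) := hξk.2
    constructor <;> linarith [hs.1, hs.2]
  rw [hsum, Real.dist_eq, ← Finset.sum_sub_distrib]
  refine (Finset.abs_sum_le_sum_abs _ _).trans_lt ((Finset.sum_le_sum hterm).trans_lt ?_)
  rw [Finset.sum_const, Finset.card_range, nsmul_eq_mul]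
  have : (m : ℝ) * (ε / (C * T + 1) * C * (T / m)) = ε * (C * T / (C * T + 1)) := by
    field_simp
  rw [this]
  have h5 : C * T / (C * T + 1) < 1 := by rw [div_lt_one (by positivity)]; linarith
  nlinarith

/-- Variation of constants for the integrated velocity of a damped particle with forcing `w`. -/
theorem integral_velocity_eq {γ c u₀ : ℝ} (hγ : γ ≠ 0) {u w : ℝ → ℝ} (hu : Continuous u)
    (hw : Continuous w)
    (h : ∀ t, 0 ≤ t → u t = u₀ - γ * (∫ s in (0 : ℝ)..t, u s) + c * w t) {t : ℝ} (ht : 0 ≤ t) :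
    ∫ s in (0 : ℝ)..t, u s = u₀ * ((1 - Real.exp (-(γ * t))) / γ) +
      c * ∫ s in (0 : ℝ)..t, w s * Real.exp (-(γ * (t - s))) := by
  -- The integrated velocity `I` solves `I' + γ I = u₀ + c w`, for which `exp (γ r)` is the
  -- integrating factor.
  have hd : ∀ s ∈ Set.uIcc 0 t, HasDerivAt
      (fun r => Real.exp (γ * r) * ∫ x in (0 : ℝ)..r, u x)
      (Real.exp (γ * s) * (u₀ + c * w s)) s := by
    intro s hs
    rw [Set.uIcc_of_le ht] at hs
    have h1 : HasDerivAt (fun r => ∫ x in (0 : ℝ)..r, u x) (u s) s :=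
      intervalIntegral.integral_hasDerivAt_right (hu.intervalIntegrable _ _)
        hu.stronglyMeasurable.stronglyMeasurableAtFilter hu.continuousAt
    have h2 : HasDerivAt (fun r => Real.exp (γ * r)) (Real.exp (γ * s) * (γ * 1)) s :=
      ((hasDerivAt_id s).const_mul γ).exp
    refine (h2.mul h1).congr_deriv ?_
    have := h s hs.1
    linear_combination Real.exp (γ * s) * this
  have h3 := intervalIntegral.integral_eq_sub_of_hasDerivAt hd
    ((by fun_prop : Continuous fun s => Real.exp (γ * s) * (u₀ + c * w s)).intervalIntegrable _ _)
  have h4 : ∫ s in (0 : ℝ)..t, Real.exp (γ * s) * (u₀ + c * w s) =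
      u₀ * ((Real.exp (γ * t) - 1) / γ) +
        c * (Real.exp (γ * t) * ∫ s in (0 : ℝ)..t, w s * Real.exp (-(γ * (t - s)))) := by
    have h5 : ∀ s, Real.exp (γ * s) * (u₀ + c * w s) = u₀ * Real.exp (γ * s) +
        c * (Real.exp (γ * t) * (w s * Real.exp (-(γ * (t - s))))) := by
      intro s
      have : Real.exp (γ * s) = Real.exp (γ * t) * Real.exp (-(γ * (t - s))) := by
        rw [← Real.exp_add]; ring_nf
      rw [this]; ring
    simp_rw [h5]
    rw [intervalIntegral.integral_add (Continuous.intervalIntegrable (by fun_prop) _ _)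
      (Continuous.intervalIntegrable (by fun_prop) _ _)]
    simp_rw [intervalIntegral.integral_const_mul]
    rw [intervalIntegral.integral_comp_mul_left (fun x => Real.exp x) hγ, integral_exp]
    simp only [mul_zero, Real.exp_zero, smul_eq_mul]
    ring
  simp only [intervalIntegral.integral_same, mul_zero, sub_zero] at h3
  rw [h4] at h3
  have he : Real.exp (γ * t) * Real.exp (-(γ * t)) = 1 := by rw [← Real.exp_add]; simp
  have hne := Real.exp_ne_zero (γ * t)
  apply mul_left_cancel₀ hne
  rw [← h3]
  field_simp
  linear_combination u₀ * he

/-! ### The response to a velocity kick -/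

namespace LangevinModel

/-- The displacement at time `t` caused by a unit velocity kick at time `s`. -/
noncomputable def response (γ t s : ℝ) : ℝ := (1 - Real.exp (-(γ * max (t - s) 0))) / γ

/-- The derivative of `response` in `s`, from the right. -/
noncomputable def responseDeriv (γ t s : ℝ) : ℝ :=
  if s < t then -Real.exp (-(γ * (t - s))) else 0

theorem response_of_le {γ t s : ℝ} (h : s ≤ t) :
    response γ t s = (1 - Real.exp (-(γ * (t - s)))) / γ := by
  rw [response, max_eq_left (sub_nonneg.2 h)]

theorem response_of_ge {γ t s : ℝ} (h : t ≤ s) : response γ t s = 0 := by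
  rw [response, max_eq_right (sub_nonpos.2 h)]; simp

theorem continuous_response (γ t : ℝ) : Continuous (response γ t) := by
  unfold response; fun_prop

theorem abs_responseDeriv_le {γ : ℝ} (hγ : 0 < γ) (t s : ℝ) : |responseDeriv γ t s| ≤ 1 := by
  unfold responseDeriv
  split_ifs with h
  · rw [abs_neg, Real.abs_exp, Real.exp_le_one_iff]
    have := mul_pos hγ (sub_pos.2 h)
    linarith
  · simp

theorem intervalIntegrable_responseDeriv {γ : ℝ} (hγ : 0 < γ) (t a b : ℝ) :
    IntervalIntegrable (responseDeriv γ t) volume a b := by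
  refine (intervalIntegrable_const (c := (1 : ℝ))).mono_fun ?_ ?_
  · refine Measurable.aestronglyMeasurable ?_
    unfold responseDeriv
    exact Measurable.ite measurableSet_Iio (by fun_prop) measurable_const
  · exact ae_of_all _ fun s => by simpa using abs_responseDeriv_le hγ t s

/-- The response has a kink at `s = t`; a right derivative exists everywhere and suffices for the
fundamental theorem of calculus. -/
theorem hasDerivWithinAt_response {γ : ℝ} (hγ : γ ≠ 0) (t s : ℝ) :
    HasDerivWithinAt (response γ t) (responseDeriv γ t s) (Set.Ioi s) s := by
  unfold responseDeriv
  split_ifs with h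
  · have h1 : HasDerivAt (fun r => (1 - Real.exp (-(γ * (t - r)))) / γ)
        ((0 - Real.exp (-(γ * (t - s))) * -(γ * (0 - 1))) / γ) s :=
      ((hasDerivAt_const s (1 : ℝ)).sub
        ((((hasDerivAt_const s t).sub (hasDerivAt_id s)).const_mul γ).neg.exp)).div_const γ
    have h2 : HasDerivAt (response γ t) (-Real.exp (-(γ * (t - s)))) s := by
      refine (h1.congr_of_eventuallyEq ?_).congr_deriv (by field_simp; ring)
      filter_upwards [Iio_mem_nhds h] with r hr
      exact response_of_le (le_of_lt hr)
    exact h2.hasDerivWithinAt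
  · push Not at h
    refine (hasDerivWithinAt_const s _ (0 : ℝ)).congr (fun r hr => ?_) (response_of_ge h)
    exact response_of_ge (h.trans (le_of_lt hr))

theorem response_sub_response {γ : ℝ} (hγ : 0 < γ) (t a b : ℝ) :
    response γ t b - response γ t a = ∫ s in a..b, responseDeriv γ t s :=
  (intervalIntegral.integral_eq_sub_of_hasDeriv_right (continuous_response γ t).continuousOn
    (fun s _ => hasDerivWithinAt_response hγ.ne' t s)
    (intervalIntegrable_responseDeriv hγ t a b)).symm

/-- Kicks after time `t` do not move the particle before `t`, so the horizon `T` drops out. This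
lets one partition of `[0, T]` serve all the increments. -/
theorem integral_mul_responseDeriv {γ : ℝ} (hγ : 0 < γ) {w : ℝ → ℝ} (hw : Continuous w)
    {t T : ℝ} (ht : 0 ≤ t) (htT : t ≤ T) :
    ∫ s in (0 : ℝ)..T, w s * responseDeriv γ t s =
      -∫ s in (0 : ℝ)..t, w s * Real.exp (-(γ * (t - s))) := by
  have hi : ∀ a b, IntervalIntegrable (fun s => w s * responseDeriv γ t s) volume a b :=
    fun a b => (intervalIntegrable_responseDeriv hγ t a b).continuousOn_mul hw.continuousOn
  rw [← intervalIntegral.integral_add_adjacent_intervals (hi 0 t) (hi t T),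
    ← intervalIntegral.integral_neg,
    intervalIntegral.integral_congr_Ioo_of_le (g := fun s => -(w s * Real.exp (-(γ * (t - s))))) ht
      fun s hs => by simp [responseDeriv, hs.2],
    intervalIntegral.integral_congr_Ioo_of_le (g := fun _ => (0 : ℝ)) htT
      fun s hs => by simp [responseDeriv, hs.1.le.not_gt]]
  simp

/-- The response to the increments of a continuous path along a refining partition converges to
the exponentially weighted integral of the path. -/
theorem tendsto_sum_response_mul_sub {γ : ℝ} (hγ : 0 < γ) {w : ℝ → ℝ} (hw : Continuous w)
    (hw0 : w 0 = 0) {t T : ℝ} (ht : 0 ≤ t) (htT : t ≤ T) :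
    Tendsto (fun m : ℕ => ∑ k ∈ Finset.range m, response γ t ((k : ℝ) * (T / m)) *
        (w (((k + 1 : ℕ) : ℝ) * (T / m)) - w ((k : ℝ) * (T / m))))
      atTop (𝓝 (∫ s in (0 : ℝ)..t, w s * Real.exp (-(γ * (t - s))))) := by
  have hT := ht.trans htT
  have h := (tendsto_riemannStieltjes_sum (C := 1) hT hw
    (intervalIntegrable_responseDeriv hγ t) (abs_responseDeriv_le hγ t)
    (fun a b _ => response_sub_response hγ t a b)
    (ξ := fun m k => ((k + 1 : ℕ) : ℝ) * (T / m)) fun m k =>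
      ⟨mul_le_mul_of_nonneg_right (by push_cast; linarith) (by positivity), le_rfl⟩).neg
  rw [integral_mul_responseDeriv hγ hw ht htT, neg_neg] at h
  refine h.congr' ?_
  filter_upwards [eventually_gt_atTop 0] with m hm
  have hm0 : (m : ℝ) ≠ 0 := by exact_mod_cast hm.ne'
  -- Summation by parts, which is why the path was sampled at right endpoints above. The boundary
  -- terms vanish: `w 0 = 0` at the start, and the response is zero at `T ≥ t`.
  have key : ∀ n : ℕ, ∑ k ∈ Finset.range n, response γ t ((k : ℝ) * (T / m)) *
        (w (((k + 1 : ℕ) : ℝ) * (T / m)) - w ((k : ℝ) * (T / m))) =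
      response γ t ((n : ℝ) * (T / m)) * w ((n : ℝ) * (T / m)) -
        ∑ k ∈ Finset.range n, w (((k + 1 : ℕ) : ℝ) * (T / m)) *
          (response γ t (((k + 1 : ℕ) : ℝ) * (T / m)) - response γ t ((k : ℝ) * (T / m))) := by
    intro n
    induction n with
    | zero => simp [hw0]
    | succ n ih => rw [Finset.sum_range_succ, Finset.sum_range_succ, ih]; ring
  have hmT : (m : ℝ) * (T / m) = T := by field_simp
  rw [key m, hmT, response_of_ge htT]
  ring

/-! ### Increment responses and the covariance matrix -/

/-- The response of the `n`-th increment to a unit velocity kick at time `s`. -/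
noncomputable def incrResponse (γ τ : ℝ) (n : ℕ) (s : ℝ) : ℝ :=
  response γ (((n : ℝ) + 1) * τ) s - response γ ((n : ℝ) * τ) s

theorem continuous_incrResponse (γ τ : ℝ) (n : ℕ) : Continuous (incrResponse γ τ n) :=
  (continuous_response _ _).sub (continuous_response _ _)

theorem incrResponse_of_ge {γ τ s : ℝ} (hτ : 0 < τ) {n : ℕ} (h : ((n : ℝ) + 1) * τ ≤ s) :
    incrResponse γ τ n s = 0 := by
  rw [incrResponse, response_of_ge h, response_of_ge (by linarith), sub_zero]

/-- The exponentials are split into factors in `s`, `n τ` and `τ`, so that products of responses are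
polynomials in `exp (γ s)`, ready for `integral_exp_poly`, and the remaining algebra is rational. -/
theorem incrResponse_of_mem {γ τ s : ℝ} {n : ℕ} (h1 : (n : ℝ) * τ ≤ s)
    (h2 : s ≤ ((n : ℝ) + 1) * τ) :
    incrResponse γ τ n s =
      (1 - Real.exp (γ * s) / (Real.exp (γ * (n * τ)) * Real.exp (γ * τ))) / γ := by
  rw [incrResponse, response_of_le h2, response_of_ge h1, sub_zero, ← Real.exp_add, ← Real.exp_sub]
  ring_nf

theorem incrResponse_of_le {γ τ s : ℝ} (hτ : 0 < τ) {n : ℕ} (h : s ≤ (n : ℝ) * τ) :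
    incrResponse γ τ n s =
      (1 - 1 / Real.exp (γ * τ)) / γ * (Real.exp (γ * s) / Real.exp (γ * (n * τ))) := by
  rw [incrResponse, response_of_le h, response_of_le (by linarith)]
  have h1 : Real.exp (-(γ * (n * τ - s))) = Real.exp (γ * s) / Real.exp (γ * (n * τ)) := by
    rw [← Real.exp_sub]; ring_nf
  have h2 : Real.exp (-(γ * ((n + 1) * τ - s))) =
      Real.exp (γ * s) / (Real.exp (γ * (n * τ)) * Real.exp (γ * τ)) := by
    rw [← Real.exp_add, ← Real.exp_sub]; ring_nf
  rw [h1, h2]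
  have := Real.exp_ne_zero (γ * τ)
  have := Real.exp_ne_zero (γ * (n * τ))
  by_cases hγ : γ = 0
  · simp [hγ]
  field_simp
  ring

theorem integral_exp_poly {γ : ℝ} (hγ : γ ≠ 0) (a b c₀ c₁ c₂ : ℝ) :
    ∫ s in a..b, (c₀ + c₁ * Real.exp (γ * s) + c₂ * Real.exp (γ * s) ^ 2) =
      c₀ * (b - a) + c₁ * ((Real.exp (γ * b) - Real.exp (γ * a)) / γ) +
        c₂ * ((Real.exp (γ * b) ^ 2 - Real.exp (γ * a) ^ 2) / (2 * γ)) := by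
  have hd : ∀ s ∈ Set.uIcc a b, HasDerivAt
      (fun r => c₀ * r + c₁ * (Real.exp (γ * r) / γ) + c₂ * (Real.exp (γ * r) ^ 2 / (2 * γ)))
      (c₀ + c₁ * Real.exp (γ * s) + c₂ * Real.exp (γ * s) ^ 2) s := by
    intro s _
    have h1 : HasDerivAt (fun r => Real.exp (γ * r)) (Real.exp (γ * s) * (γ * 1)) s :=
      ((hasDerivAt_id s).const_mul γ).exp
    refine ((((hasDerivAt_id s).const_mul c₀).add ((h1.div_const γ).const_mul c₁)).add
      (((h1.pow 2).div_const (2 * γ)).const_mul c₂)).congr_deriv ?_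
    field_simp
    push_cast
    ring
  rw [intervalIntegral.integral_eq_sub_of_hasDerivAt hd
    (Continuous.intervalIntegrable (by fun_prop) _ _)]
  ring

/-- The response of step `i` vanishes once the step is over, so only the past of the step and the
step itself contribute. -/
theorem integral_incrResponse_mul {γ τ : ℝ} (hτ : 0 < τ) {i j N : ℕ} (hi : i < N) :
    ∫ s in (0 : ℝ)..((N : ℝ) * τ), incrResponse γ τ i s * incrResponse γ τ j s =
      (∫ s in (0 : ℝ)..((i : ℝ) * τ), incrResponse γ τ i s * incrResponse γ τ j s) +
      ∫ s in ((i : ℝ) * τ)..(((i : ℝ) + 1) * τ),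
        incrResponse γ τ i s * incrResponse γ τ j s := by
  have hc : ∀ a b, IntervalIntegrable (fun s => incrResponse γ τ i s * incrResponse γ τ j s)
      volume a b := fun a b =>
    ((continuous_incrResponse γ τ i).mul (continuous_incrResponse γ τ j)).intervalIntegrable _ _
  have hle : ((i : ℝ) + 1) * τ ≤ N * τ :=
    mul_le_mul_of_nonneg_right (by exact_mod_cast hi) hτ.le
  rw [intervalIntegral.integral_add_adjacent_intervals (hc _ _) (hc _ _),
    ← intervalIntegral.integral_add_adjacent_intervals (hc 0 (((i : ℝ) + 1) * τ)) (hc _ (N * τ)),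
    intervalIntegral.integral_congr_Ioo_of_le (a := ((i : ℝ) + 1) * τ) (g := fun _ => (0 : ℝ)) hle
      fun s hs => by simp [incrResponse_of_ge hτ hs.1.le]]
  simp

theorem integral_incrResponse_mul_past {γ τ : ℝ} (hγ : γ ≠ 0) (hτ : 0 < τ) {i j : ℕ}
    (hij : i ≤ j) :
    ∫ s in (0 : ℝ)..((i : ℝ) * τ), incrResponse γ τ i s * incrResponse γ τ j s =
      ((1 - 1 / Real.exp (γ * τ)) / γ) ^ 2 /
        (Real.exp (γ * (i * τ)) * Real.exp (γ * (j * τ))) *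
          ((Real.exp (γ * (i * τ)) ^ 2 - 1) / (2 * γ)) := by
  have hij' : (i : ℝ) * τ ≤ j * τ :=
    mul_le_mul_of_nonneg_right (by exact_mod_cast hij) hτ.le
  rw [intervalIntegral.integral_congr_Ioo_of_le (g := fun s => 0 + 0 * Real.exp (γ * s) +
    (((1 - 1 / Real.exp (γ * τ)) / γ) ^ 2 / (Real.exp (γ * (i * τ)) * Real.exp (γ * (j * τ)))) *
      Real.exp (γ * s) ^ 2) (by positivity) fun s hs => by
      simp only [incrResponse_of_le hτ hs.2.le, incrResponse_of_le hτ (hs.2.le.trans hij')]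
      field_simp
      ring, integral_exp_poly hγ]
  simp

/-- Put `y = (i+1)τ - s` and `g(y) = (1 - exp (-γy))/γ`. The earlier response is `g` and the later
one is proportional to `g'`, so the integral of `g g'` gives `g(τ)²/2`; the third factor `g(τ)` is
the amplitude of the later response. -/
theorem integral_incrResponse_mul_present {γ τ : ℝ} (hγ : γ ≠ 0) (hτ : 0 < τ) {i j : ℕ}
    (hij : i < j) :
    ∫ s in ((i : ℝ) * τ)..(((i : ℝ) + 1) * τ), incrResponse γ τ i s * incrResponse γ τ j s =
      ((1 - 1 / Real.exp (γ * τ)) / γ) ^ 3 / 2 *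
        (Real.exp (γ * (i * τ)) * Real.exp (γ * τ) / Real.exp (γ * (j * τ))) := by
  have hij' : ((i : ℝ) + 1) * τ ≤ j * τ :=
    mul_le_mul_of_nonneg_right (by exact_mod_cast hij) hτ.le
  have hE : Real.exp (γ * ((i + 1) * τ)) = Real.exp (γ * (i * τ)) * Real.exp (γ * τ) := by
    rw [← Real.exp_add]; ring_nf
  rw [intervalIntegral.integral_congr_Ioo_of_le (g := fun s => 0 +
    ((1 - 1 / Real.exp (γ * τ)) / γ ^ 2 / Real.exp (γ * (j * τ))) * Real.exp (γ * s) +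
    (-((1 - 1 / Real.exp (γ * τ)) / γ ^ 2 / Real.exp (γ * (j * τ)) /
      (Real.exp (γ * (i * τ)) * Real.exp (γ * τ)))) * Real.exp (γ * s) ^ 2)
    (by nlinarith) fun s hs => by
      simp only [incrResponse_of_mem hs.1.le hs.2.le, incrResponse_of_le hτ (hs.2.le.trans hij')]
      field_simp
      ring, integral_exp_poly hγ, hE]
  field_simp
  ring

theorem integral_incrResponse_sq_present {γ τ : ℝ} (hγ : γ ≠ 0) (hτ : 0 < τ) (i : ℕ) :
    ∫ s in ((i : ℝ) * τ)..(((i : ℝ) + 1) * τ), incrResponse γ τ i s * incrResponse γ τ i s =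
      (τ - 2 * (1 - 1 / Real.exp (γ * τ)) / γ + (1 - 1 / Real.exp (γ * τ) ^ 2) / (2 * γ)) /
        γ ^ 2 := by
  have hE : Real.exp (γ * ((i + 1) * τ)) = Real.exp (γ * (i * τ)) * Real.exp (γ * τ) := by
    rw [← Real.exp_add]; ring_nf
  rw [intervalIntegral.integral_congr_Ioo_of_le (g := fun s => 1 / γ ^ 2 +
    (-2 / γ ^ 2 / (Real.exp (γ * (i * τ)) * Real.exp (γ * τ))) * Real.exp (γ * s) +
    (1 / γ ^ 2 / (Real.exp (γ * (i * τ)) * Real.exp (γ * τ)) ^ 2) * Real.exp (γ * s) ^ 2)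
    (by nlinarith) fun s hs => by
      simp only [incrResponse_of_mem hs.1.le hs.2.le]
      field_simp
      ring, integral_exp_poly hγ, hE]
  field_simp
  ring

/-- The increments have the covariance `lagCov`: the initial velocity and the noise contribute
through the responses of the increments. -/
theorem lagCov_eq_of_le {γ k τ : ℝ} (hγ : 0 < γ) (hτ : 0 < τ) {i j N : ℕ} (hi : i < N)
    (hij : i ≤ j) :
    k * γ * (incrResponse γ τ i 0 * incrResponse γ τ j 0) + 2 * k * γ ^ 2 *
      ∫ s in (0 : ℝ)..((N : ℝ) * τ), incrResponse γ τ i s * incrResponse γ τ j s =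
      lagCov γ k τ (j - i) := by
  have hγ' := hγ.ne'
  rw [integral_incrResponse_mul hτ hi, integral_incrResponse_mul_past hγ' hτ hij,
    incrResponse_of_le hτ (by positivity), incrResponse_of_le hτ (by positivity)]
  have hx : Real.exp (-(γ * τ)) = 1 / Real.exp (γ * τ) := by rw [Real.exp_neg, one_div]
  unfold lagCov phi
  rw [hx, mul_zero, Real.exp_zero]
  -- Stationarity enters here: the initial-velocity term, with variance `kγ`, cancels the `-1` that
  -- the lower limit `0` contributes to the past integral. What remains depends on `j - i` only.
  rcases hij.eq_or_lt with rfl | hlt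
  · rw [integral_incrResponse_sq_present hγ' hτ, Nat.sub_self, if_pos rfl]
    field_simp
    ring
  · rw [integral_incrResponse_mul_present hγ' hτ hlt, if_neg (by omega), Nat.cast_sub hij]
    have hm : Real.exp (-((j : ℝ) - i - 1) * (γ * τ)) =
        Real.exp (γ * (i * τ)) * Real.exp (γ * τ) / Real.exp (γ * (j * τ)) := by
      rw [← Real.exp_add, ← Real.exp_sub]; ring_nf
    rw [hm]
    field_simp
    ring

theorem covMatrix_apply_eq {γ k τ : ℝ} (hγ : 0 < γ) (hτ : 0 < τ) {N : ℕ} (i j : Fin N) :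
    covMatrix γ k τ N i j =
    k * γ * (incrResponse γ τ i 0 * incrResponse γ τ j 0) + 2 * k * γ ^ 2 *
      ∫ s in (0 : ℝ)..((N : ℝ) * τ), incrResponse γ τ i s * incrResponse γ τ j s := by
  rcases le_total i j with h | h
  · rw [lagCov_eq_of_le hγ hτ i.2 h, covMatrix, Matrix.of_apply]
    congr 1
    have : (i : ℕ) ≤ j := h
    omega
  · simp_rw [mul_comm (incrResponse γ τ i _)]
    rw [lagCov_eq_of_le hγ hτ j.2 h, covMatrix, Matrix.of_apply]
    congr 1
    have : (j : ℕ) ≤ i := h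
    omega

theorem covMatrix_posDef {γ k τ : ℝ} (hγ : 0 < γ) (hk : 0 < k) (hτ : 0 < τ) (N : ℕ) :
    (covMatrix γ k τ N).PosDef := by
  refine Matrix.PosDef.of_dotProduct_mulVec_pos ?_ fun v hv => ?_
  · ext i j
    simp only [Matrix.conjTranspose_apply, star_trivial, covMatrix_apply_eq hγ hτ, mul_comm]
  set f : ℝ → ℝ := fun s => ∑ n, v n * incrResponse γ τ n s with hf
  have hfc : Continuous f :=
    continuous_finsetSum _ fun n _ => continuous_const.mul (continuous_incrResponse γ τ n)
  have hff : ∀ s, f s * f s = ∑ i, ∑ j, v i * v j *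
      (incrResponse γ τ i s * incrResponse γ τ j s) := by
    intro s
    rw [hf, Finset.sum_mul_sum]
    exact Finset.sum_congr rfl fun i _ => Finset.sum_congr rfl fun j _ => by ring
  have hint : ∫ s in (0 : ℝ)..((N : ℝ) * τ), f s * f s = ∑ i, ∑ j, v i * v j *
      ∫ s in (0 : ℝ)..((N : ℝ) * τ), incrResponse γ τ i s * incrResponse γ τ j s := by
    have hc : ∀ i j : Fin N, Continuous fun s => v i * v j *
      (incrResponse γ τ i s * incrResponse γ τ j s) := fun i j =>
        continuous_const.mul ((continuous_incrResponse γ τ i).mul (continuous_incrResponse γ τ j))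
    simp_rw [hff]
    rw [intervalIntegral.integral_finsetSum fun i _ =>
      (continuous_finsetSum _ fun j _ => hc i j).intervalIntegrable _ _]
    refine Finset.sum_congr rfl fun i _ => ?_
    rw [intervalIntegral.integral_finsetSum fun j _ => (hc i j).intervalIntegrable _ _]
    simp_rw [intervalIntegral.integral_const_mul]
  have hquad : star v ⬝ᵥ (covMatrix γ k τ N *ᵥ v) = k * γ * (f 0 * f 0) +
      2 * k * γ ^ 2 * ∫ s in (0 : ℝ)..((N : ℝ) * τ), f s * f s := by
    rw [hint, hff]
    simp only [dotProduct, Matrix.mulVec, star_trivial, Finset.mul_sum, ← Finset.sum_add_distrib,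
      covMatrix_apply_eq hγ hτ]
    exact Finset.sum_congr rfl fun i _ => Finset.sum_congr rfl fun j _ => by ring
  rw [hquad]
  -- With `n` the last index where `v` is nonzero, only the `n`-th term of `f` survives at time `n
  -- τ`: earlier responses have ended by then and later coefficients are zero. By continuity `∫ f²`
  -- is then positive.
  obtain ⟨n, hn, hmax⟩ : ∃ n, v n ≠ 0 ∧ ∀ m, n < m → v m = 0 := by
    have hne : (Finset.univ.filter fun n => v n ≠ 0).Nonempty := by
      obtain ⟨n, hn⟩ := Function.ne_iff.1 hv
      exact ⟨n, by simpa using hn⟩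
    refine ⟨_, (Finset.mem_filter.1 (Finset.max'_mem _ hne)).2, fun m hm => ?_⟩
    by_contra h
    exact hm.not_ge (Finset.le_max' _ m (by simpa using h))
  have hE : 1 < Real.exp (γ * τ) := Real.one_lt_exp_iff.2 (by positivity)
  have hfn : f ((n : ℕ) * τ) ≠ 0 := by
    have : f ((n : ℕ) * τ) = v n * ((1 - 1 / Real.exp (γ * τ)) / γ) := by
      rw [hf]
      simp only
      rw [Finset.sum_eq_single n]
      · rw [incrResponse_of_le hτ le_rfl, div_self (Real.exp_ne_zero _), mul_one]
      · intro m _ hmn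
        rcases lt_or_gt_of_ne hmn with h | h
        · rw [incrResponse_of_ge hτ, mul_zero]
          exact mul_le_mul_of_nonneg_right (by exact_mod_cast h) hτ.le
        · rw [hmax m h, zero_mul]
      · simp
    rw [this]
    refine mul_ne_zero hn (div_ne_zero (sub_ne_zero.2 ?_) hγ.ne')
    exact ((div_lt_one (by positivity)).2 hE).ne'
  have hN : (0 : ℝ) < N := by exact_mod_cast n.pos
  have hpos : 0 < ∫ s in (0 : ℝ)..((N : ℝ) * τ), f s * f s :=
    intervalIntegral.integral_pos (by positivity) (hfc.mul hfc).continuousOn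
      (fun s _ => mul_self_nonneg _)
      ⟨(n : ℕ) * τ, ⟨by positivity, mul_le_mul_of_nonneg_right
        (by exact_mod_cast n.2.le) hτ.le⟩, mul_self_pos.2 hfn⟩
  have := mul_self_nonneg (f 0)
  positivity

/-! ### Pathwise approximation of the increments -/

/-- The approximation of the `n`-th increment by a linear function of the initial velocity and of
the increments of the driving path along the uniform partition of `[0, T]` into `m` intervals. -/
noncomputable def incrApprox (γ c τ T : ℝ) (m n : ℕ) (x : ℝ × (ℝ≥0 → ℝ)) : ℝ :=
  incrResponse γ τ n 0 * x.1 + ∑ k : Fin m, c * incrResponse γ τ n ((k : ℝ) * (T / m)) *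
    (x.2 ((((k : ℕ) + 1 : ℕ) : ℝ) * (T / m)).toNNReal - x.2 ((k : ℝ) * (T / m)).toNNReal)

theorem measurable_incrApprox (γ c τ T : ℝ) (m n : ℕ) : Measurable (incrApprox γ c τ T m n) := by
  unfold incrApprox; fun_prop

/-- The almost sure limit of `incrApprox`, as a measurable function of the data. -/
noncomputable def incrLimit (γ c τ T : ℝ) (n : ℕ) (x : ℝ × (ℝ≥0 → ℝ)) : ℝ :=
  limsup (fun m => incrApprox γ c τ T m n x) atTop

theorem measurable_incrLimit (γ c τ T : ℝ) (n : ℕ) : Measurable (incrLimit γ c τ T n) :=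
  Measurable.limsup fun m => measurable_incrApprox γ c τ T m n

/-- A statement about a single path: in integrated form the forcing `b` enters undifferentiated, so
variation of constants needs only its continuity. Subtracting the limits for the two endpoints of
the step gives the increment. -/
theorem tendsto_incrApprox {γ c τ u₀ : ℝ} (hγ : 0 < γ) (hτ : 0 ≤ τ) {N n : ℕ} (hn : n < N)
    {b : ℝ≥0 → ℝ} (hb : Continuous b) (hb0 : b 0 = 0) {v : ℝ → ℝ} (hv : Continuous v)
    (h : ∀ t, 0 ≤ t → v t = u₀ - γ * (∫ s in (0 : ℝ)..t, v s) + c * b t.toNNReal) :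
    Tendsto (fun m => incrApprox γ c τ (N * τ) m n (u₀, b)) atTop
      (𝓝 ((∫ s in (0 : ℝ)..(((n : ℝ) + 1) * τ), v s) - ∫ s in (0 : ℝ)..((n : ℝ) * τ), v s)) := by
  have hw : Continuous fun s : ℝ => b s.toNNReal := hb.comp continuous_real_toNNReal
  have hw0 : b (0 : ℝ).toNNReal = 0 := by simpa using hb0
  have h1 : 0 ≤ (n : ℝ) * τ := by positivity
  have h2 : 0 ≤ ((n : ℝ) + 1) * τ := by positivity
  have h4 : ((n : ℝ) + 1) * τ ≤ N * τ := mul_le_mul_of_nonneg_right (by exact_mod_cast hn) hτ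
  have h3 : (n : ℝ) * τ ≤ N * τ := by linarith
  rw [integral_velocity_eq hγ.ne' hv hw h h1, integral_velocity_eq hγ.ne' hv hw h h2]
  have hlim := (((tendsto_sum_response_mul_sub hγ hw hw0 h2 h4).sub
    (tendsto_sum_response_mul_sub hγ hw hw0 h1 h3)).const_mul c).const_add
      (incrResponse γ τ n 0 * u₀)
  have hval : incrResponse γ τ n 0 * u₀ + c *
      ((∫ s in (0 : ℝ)..(((n : ℝ) + 1) * τ),
          b s.toNNReal * Real.exp (-(γ * (((n : ℝ) + 1) * τ - s)))) -
        ∫ s in (0 : ℝ)..((n : ℝ) * τ), b s.toNNReal * Real.exp (-(γ * ((n : ℝ) * τ - s)))) =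
      u₀ * ((1 - Real.exp (-(γ * (((n : ℝ) + 1) * τ)))) / γ) +
        c * (∫ s in (0 : ℝ)..(((n : ℝ) + 1) * τ),
          b s.toNNReal * Real.exp (-(γ * (((n : ℝ) + 1) * τ - s)))) -
      (u₀ * ((1 - Real.exp (-(γ * ((n : ℝ) * τ)))) / γ) +
        c * ∫ s in (0 : ℝ)..((n : ℝ) * τ),
          b s.toNNReal * Real.exp (-(γ * ((n : ℝ) * τ - s)))) := by
    rw [incrResponse, response_of_le h1, response_of_le h2, sub_zero, sub_zero]
    ring
  rw [hval] at hlim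
  refine hlim.congr fun m => ?_
  rw [incrApprox, ← Finset.sum_sub_distrib, Finset.mul_sum, Finset.sum_range]
  congr 1
  refine Finset.sum_congr rfl fun k _ => ?_
  rw [incrResponse]
  ring

/-! ### Gaussian law and covariances of the approximations -/

section Law

variable {Ω : Type*} [MeasurableSpace Ω] {P : Measure Ω}
  {B : ℝ≥0 → Ω → ℝ} {u : Ω → ℝ} {σ : ℝ≥0}

theorem hasGaussianLaw_incrApprox (hB : IsPreBrownianReal B P)
    (hu : HasLaw u (gaussianReal 0 σ) P)
    (huB : IndepFun u (fun ω t => B t ω) P) (γ c τ T : ℝ) (m N : ℕ) :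
    HasGaussianLaw (fun ω (n : Fin N) => incrApprox γ c τ T m n (u ω, fun t => B t ω)) P := by
  have hE := hB.isGaussianProcess.hasGaussianLaw_increments (n := m)
    (t := fun k : Fin (m + 1) => ((k : ℝ) * (T / m)).toNNReal)
  have hind : IndepFun u (fun ω (k : Fin m) => B (((k.succ : Fin (m + 1)) : ℝ) * (T / m)).toNNReal ω
      - B (((k.castSucc : Fin (m + 1)) : ℝ) * (T / m)).toNNReal ω) P :=
    huB.comp (φ := id) (ψ := fun (b : ℝ≥0 → ℝ) (k : Fin m) =>
      b (((k.succ : Fin (m + 1)) : ℝ) * (T / m)).toNNReal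
      - b (((k.castSucc : Fin (m + 1)) : ℝ) * (T / m)).toNNReal) measurable_id (by fun_prop)
  have hG := hind.hasGaussianLaw hu.hasGaussianLaw hE
  let L : (ℝ × (Fin m → ℝ)) →L[ℝ] (Fin N → ℝ) := ContinuousLinearMap.pi fun n =>
    incrResponse γ τ n 0 • ContinuousLinearMap.fst ℝ ℝ (Fin m → ℝ) +
      ∑ k : Fin m, (c * incrResponse γ τ n ((k : ℝ) * (T / m))) •
        ((ContinuousLinearMap.proj k).comp (ContinuousLinearMap.snd ℝ ℝ (Fin m → ℝ)))
  have hL : (fun ω (n : Fin N) => incrApprox γ c τ T m n (u ω, fun t => B t ω)) = fun ω =>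
      L (u ω, fun k : Fin m => B (((k.succ : Fin (m + 1)) : ℝ) * (T / m)).toNNReal ω
        - B (((k.castSucc : Fin (m + 1)) : ℝ) * (T / m)).toNNReal ω) := by
    ext ω n
    simp [L, incrApprox]
  rw [hL]
  exact hG.map_fun L

theorem integral_incrApprox [IsProbabilityMeasure P] (hB : IsPreBrownianReal B P)
    (hu : HasLaw u (gaussianReal 0 σ) P)
    (γ c τ T : ℝ) (m n : ℕ) :
    ∫ ω, incrApprox γ c τ T m n (u ω, fun t => B t ω) ∂P = 0 := by
  have hui : Integrable u P := hu.hasGaussianLaw.integrable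
  have hu0 : ∫ ω, u ω ∂P = 0 := by rw [hu.integral_eq, integral_id_gaussianReal]
  have hBi := hB.integrable_eval
  have hB0 : ∀ t, ∫ ω, B t ω ∂P = 0 := hB.integral_eval
  have hEi : ∀ k : Fin m, Integrable (fun ω => c * incrResponse γ τ n ((k : ℝ) * (T / m)) *
      (B ((((k : ℕ) + 1 : ℕ) : ℝ) * (T / m)).toNNReal ω - B ((k : ℝ) * (T / m)).toNNReal ω)) P :=
    fun k => ((hBi _).sub (hBi _)).const_mul _
  simp only [incrApprox]
  rw [integral_add (hui.const_mul _) (integrable_finsetSum _ fun k _ => hEi k),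
    integral_finsetSum _ fun k _ => hEi k]
  simp_rw [integral_const_mul, integral_sub (hBi _) (hBi _)]
  simp [hB0, hu0]

theorem covariance_increment_partition [IsProbabilityMeasure P]
    (hB : IsPreBrownianReal B P) {h : ℝ} (hh : 0 ≤ h)
    {m : ℕ} (k l : Fin m) :
    cov[fun ω => B ((((k : ℕ) + 1 : ℕ) : ℝ) * h).toNNReal ω - B ((k : ℝ) * h).toNNReal ω,
      fun ω => B ((((l : ℕ) + 1 : ℕ) : ℝ) * h).toNNReal ω - B ((l : ℝ) * h).toNNReal ω; P] =
      if k = l then h else 0 := by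
  have hL : ∀ t, MemLp (fun ω => B t ω) 2 P :=
    fun t => (hB.isGaussianProcess.hasGaussianLaw_eval t).memLp_two
  rw [covariance_fun_sub_fun_sub (hL _) (hL _) (hL _) (hL _)]
  simp_rw [hB.covariance_fun_eval, NNReal.coe_min]
  have hc : ∀ j : ℕ, (((j : ℝ) * h).toNNReal : ℝ) = j * h :=
    fun j => Real.coe_toNNReal _ (by positivity)
  -- The four Brownian covariances become minima of natural numbers, which the order of `k` and `l`
  -- decides.
  simp only [hc, ← min_mul_of_nonneg _ _ hh, ← Nat.cast_min]
  rcases lt_trichotomy k l with hkl | rfl | hkl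
  · have h' : (k : ℕ) < l := hkl
    rw [if_neg hkl.ne, min_eq_left (by omega : (k : ℕ) + 1 ≤ l + 1),
      min_eq_left (by omega : (k : ℕ) + 1 ≤ l), min_eq_left (by omega : (k : ℕ) ≤ l + 1),
      min_eq_left (by omega : (k : ℕ) ≤ l)]
    ring
  · rw [if_pos rfl, min_self, min_self, min_eq_right (by omega : (k : ℕ) ≤ k + 1),
      min_eq_left (by omega : (k : ℕ) ≤ k + 1)]
    push_cast
    ring
  · have h' : (l : ℕ) < k := hkl
    rw [if_neg hkl.ne', min_eq_right (by omega : (l : ℕ) + 1 ≤ k + 1),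
      min_eq_right (by omega : (l : ℕ) ≤ k + 1), min_eq_right (by omega : (l : ℕ) + 1 ≤ k),
      min_eq_right (by omega : (l : ℕ) ≤ k)]
    ring

/-- Velocity and noise are uncorrelated, and so are distinct partition increments, so the double sum
collapses to its diagonal. The cell length stays written as a difference to match
`tendsto_riemannStieltjes_sum`. -/
theorem covariance_incrApprox [IsProbabilityMeasure P] (hB : IsPreBrownianReal B P)
    (hu : HasLaw u (gaussianReal 0 σ) P) (huB : IndepFun u (fun ω t => B t ω) P)
    (γ c τ : ℝ) {T : ℝ} (hT : 0 ≤ T) (m i j : ℕ) :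
    cov[fun ω => incrApprox γ c τ T m i (u ω, fun t => B t ω),
      fun ω => incrApprox γ c τ T m j (u ω, fun t => B t ω); P] =
      σ * (incrResponse γ τ i 0 * incrResponse γ τ j 0) + c ^ 2 *
        ∑ k ∈ Finset.range m, incrResponse γ τ i ((k : ℝ) * (T / m)) *
          incrResponse γ τ j ((k : ℝ) * (T / m)) *
            (((k + 1 : ℕ) : ℝ) * (T / m) - (k : ℝ) * (T / m)) := by
  set E : Fin m → Ω → ℝ := fun k ω =>
    B ((((k : ℕ) + 1 : ℕ) : ℝ) * (T / m)).toNNReal ω - B ((k : ℝ) * (T / m)).toNNReal ω with hE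
  have hEL : ∀ k, MemLp (E k) 2 P := fun k =>
    (hB.isGaussianProcess.hasGaussianLaw_sub).memLp_two
  have huL : MemLp u 2 P := hu.hasGaussianLaw.memLp_two
  have hcE : ∀ k l, cov[E k, E l; P] = if k = l then T / m else 0 :=
    covariance_increment_partition hB (by positivity)
  have huE : ∀ k, cov[u, E k; P] = 0 := fun k =>
    (huB.comp (φ := id) (ψ := fun b : ℝ≥0 → ℝ =>
      b ((((k : ℕ) + 1 : ℕ) : ℝ) * (T / m)).toNNReal - b ((k : ℝ) * (T / m)).toNNReal)
      measurable_id (by fun_prop)).covariance_eq_zero huL (hEL k)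
  have huu : cov[u, u; P] = σ := by
    rw [covariance_self hu.aemeasurable, hu.variance_eq, variance_id_gaussianReal]
  have hEc : ∀ n k, MemLp (fun ω => c * incrResponse γ τ n (((k : Fin m) : ℝ) * (T / m)) * E k ω)
    2 P := fun n k => (hEL k).const_mul _
  have hES : ∀ n, MemLp (fun ω => ∑ k : Fin m, c * incrResponse γ τ n ((k : ℝ) * (T / m)) * E k ω)
    2 P := fun n => memLp_finsetSum _ fun k _ => hEc n k
  have huc : ∀ n, MemLp (fun ω => incrResponse γ τ n 0 * u ω) 2 P := fun n => huL.const_mul _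
  change cov[(fun ω => incrResponse γ τ i 0 * u ω) +
      fun ω => ∑ k : Fin m, c * incrResponse γ τ i ((k : ℝ) * (T / m)) * E k ω,
    (fun ω => incrResponse γ τ j 0 * u ω) +
      fun ω => ∑ k : Fin m, c * incrResponse γ τ j ((k : ℝ) * (T / m)) * E k ω; P] = _
  rw [covariance_add_left (huc i) (hES i) ((huc j).add (hES j)),
    covariance_add_right (huc i) (huc j) (hES j),
    covariance_add_right (hES i) (huc j) (hES j),
    covariance_fun_sum_fun_sum (hEc i) (hEc j),
    covariance_fun_sum_right (hEc j) (huc i), covariance_fun_sum_left (hEc i) (huc j)]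
  simp_rw [covariance_const_mul_left, covariance_const_mul_right, covariance_comm (E _) u, huE, hcE,
    huu]
  simp only [mul_ite, mul_zero, Finset.sum_ite_eq, Finset.mem_univ, if_true, Finset.sum_const_zero,
    add_zero, zero_add, Finset.sum_range, Finset.mul_sum]
  congr 1
  · ring
  · refine Finset.sum_congr rfl fun k _ => ?_
    push_cast
    ring

theorem tendsto_covariance_incrApprox [IsProbabilityMeasure P] (hB : IsPreBrownianReal B P)
    {γ k τ : ℝ} (hγ : 0 < γ) (hk : 0 < k) (hτ : 0 < τ)
    (hu : HasLaw u (gaussianReal 0 (k * γ).toNNReal) P) (huB : IndepFun u (fun ω t => B t ω) P)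
    {N : ℕ} (i j : Fin N) :
    Tendsto (fun m => cov[
      fun ω => incrApprox γ (γ * √(2 * k)) τ (N * τ) m i (u ω, fun t => B t ω),
      fun ω => incrApprox γ (γ * √(2 * k)) τ (N * τ) m j (u ω, fun t => B t ω); P]) atTop
      (𝓝 (covMatrix γ k τ N i j)) := by
  have hT : (0 : ℝ) ≤ N * τ := by positivity
  simp_rw [covariance_incrApprox hB hu huB γ _ τ hT]
  rw [covMatrix_apply_eq hγ hτ, Real.coe_toNNReal _ (by positivity : 0 ≤ k * γ), mul_pow,
    Real.sq_sqrt (by positivity), show 2 * k * γ ^ 2 = γ ^ 2 * (2 * k) by ring]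
  refine (Tendsto.const_mul _ ?_).const_add _
  -- An ordinary Riemann sum with left endpoints: the integrator is the identity, of density `1`.
  have h := tendsto_riemannStieltjes_sum (C := 1) (q := fun _ => 1) (F := id) hT
    ((continuous_incrResponse γ τ i).mul (continuous_incrResponse γ τ j))
    (fun a b => intervalIntegrable_const) (by simp) (by simp)
    (ξ := fun m k => (k : ℝ) * ((N * τ) / m)) fun m k =>
      ⟨le_rfl, mul_le_mul_of_nonneg_right (by push_cast; linarith) (by positivity)⟩
  simpa only [id, mul_one, Pi.mul_apply] using h

/-- Whenever `Y` is the almost sure limit of the approximations, it has the law `N(0, S)`. -/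
theorem hasLaw_of_tendsto_incrApprox [IsProbabilityMeasure P] (hB : IsPreBrownianReal B P)
    {γ k τ : ℝ} (hγ : 0 < γ) (hk : 0 < k) (hτ : 0 < τ)
    (hu : HasLaw u (gaussianReal 0 (k * γ).toNNReal) P) (huB : IndepFun u (fun ω t => B t ω) P)
    {N : ℕ} {Y : Fin N → Ω → ℝ}
    (hY : ∀ᵐ ω ∂P, ∀ n : Fin N, Tendsto (fun m =>
      incrApprox γ (γ * √(2 * k)) τ (N * τ) m n (u ω, fun t => B t ω)) atTop (𝓝 (Y n ω))) :
    HasLaw (fun ω => WithLp.toLp 2 fun n => Y n ω)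
      (multivariateGaussian 0 (covMatrix γ k τ N)) P :=
  hasLaw_multivariateGaussian_of_tendsto (covMatrix_posDef hγ hk hτ N).posSemidef
    (fun m => hasGaussianLaw_incrApprox hB hu huB γ _ τ _ m N)
    (fun m n => integral_incrApprox hB hu γ _ τ _ m n)
    (fun i j => tendsto_covariance_incrApprox hB hγ hk hτ hu huB i j) hY

end Law

/-! ### From vector-valued particles to scalar coordinates -/

section Particle

variable {Ω : Type*} [MeasurableSpace Ω] {P : Measure Ω} {d : ℕ}

theorem hasLaw_coord_of_isotropic [IsProbabilityMeasure P] {V : Ω → EuclideanSpace ℝ (Fin d)}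
    {v : ℝ} (hv : 0 ≤ v)
    (hV : HasLaw V (multivariateGaussian 0 (v • (1 : Matrix (Fin d) (Fin d) ℝ))) P) (i : Fin d) :
    HasLaw (fun ω => V ω i) (gaussianReal 0 v.toNNReal) P := by
  have h := (measurePreserving_eval_multivariateGaussian (μ := 0) (i := i)
    (Matrix.PosSemidef.one.smul hv)).fun_comp_hasLaw hV
  simpa using h

/-- For jointly Gaussian coordinates, vanishing covariances imply independence. -/
theorem iIndepFun_coord_of_isotropic {V : Ω → EuclideanSpace ℝ (Fin d)} {v : ℝ} (hv : 0 ≤ v)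
    (hV : HasLaw V (multivariateGaussian 0 (v • (1 : Matrix (Fin d) (Fin d) ℝ))) P) :
    iIndepFun (fun (i : Fin d) ω => V ω i) P := by
  have hG : HasGaussianLaw (fun ω (i : Fin d) => V ω i) P :=
    hV.hasGaussianLaw.map_equiv (PiLp.continuousLinearEquiv 2 ℝ fun _ : Fin d => ℝ)
  refine hG.iIndepFun_of_covariance_eq_zero fun i j hij => ?_
  rw [hV.covariance_fun_comp (f := fun x => x i) (g := fun x => x j)
    (Measurable.aemeasurable (by fun_prop)) (Measurable.aemeasurable (by fun_prop)),
    covariance_eval_multivariateGaussian (Matrix.PosSemidef.one.smul hv)]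
  simp [hij]

/-- The drift is a scalar multiple of the velocity, so the equations decouple into scalar ones; off
one null set the deterministic limit applies to each, and the initial position cancels in the
increments. -/
theorem ae_tendsto_increment {γ k : ℝ} (hγ : 0 < γ) {X U W : ℝ≥0 → Ω → EuclideanSpace ℝ (Fin d)}
    (hW : IsBrownianVector W P) (hXU : IsLangevinSolution γ k X U W P) (τ : ℝ≥0) (N : ℕ)
    (i : Fin d) :
    ∀ᵐ ω ∂P, ∀ n : Fin N, Tendsto (fun m =>
      incrApprox γ (γ * √(2 * k)) τ (N * τ) m n (U 0 ω i, fun t => W t ω i)) atTop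
        (𝓝 (increment X τ i n ω)) := by
  filter_upwards [hXU.continuous_velocity, hXU.position_eq, hXU.velocity_eq,
    (hW.isBrownian i).cont, (hW.isBrownian i).eval_zero_ae_eq_zero] with ω hUc hX hU hWc hW0 n
  have hVc : Continuous fun s : ℝ => U s.toNNReal ω := hUc.comp continuous_real_toNNReal
  have hint : ∀ t : ℝ, (∫ s in (0 : ℝ)..t, U s.toNNReal ω) i =
      ∫ s in (0 : ℝ)..t, U s.toNNReal ω i := fun t =>
    ((EuclideanSpace.proj i : EuclideanSpace ℝ (Fin d) →L[ℝ] ℝ).intervalIntegral_comp_comm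
      (hVc.intervalIntegrable 0 t)).symm
  have hv : Continuous fun s : ℝ => U s.toNNReal ω i := by fun_prop
  have hinc : increment X τ i n ω = (∫ s in (0 : ℝ)..(((n : ℕ) : ℝ) + 1) * τ, U s.toNNReal ω i) -
      ∫ s in (0 : ℝ)..((n : ℕ) : ℝ) * τ, U s.toNNReal ω i := by
    rw [increment, hX, hX ((n : ℕ) * τ), ← hint, ← hint]
    simp
  rw [hinc]
  refine tendsto_incrApprox hγ τ.2 n.2 hWc hW0 hv fun t ht => ?_
  have h := congrArg (fun x : EuclideanSpace ℝ (Fin d) => x i) (hU t.toNNReal)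
  simpa [hint, Real.coe_toNNReal t ht] using h

end Particle

/-! ### Joint density and the main theorem -/

theorem hasLaw_gaussianDensity {Ω : Type*} [MeasurableSpace Ω] {P : Measure Ω} {n : ℕ}
    {Y : Ω → Fin n → ℝ} {S : Matrix (Fin n) (Fin n) ℝ} (hS : S.PosDef)
    (hY : HasLaw (fun ω => WithLp.toLp 2 (Y ω)) (multivariateGaussian 0 S) P) :
    HasLaw Y ((volume : Measure (Fin n → ℝ)).withDensity fun x =>
      ENNReal.ofReal (gaussianDensity x 0 S)) P := by
  rw [← map_ofLp_multivariateGaussian hS]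
  have h : HasLaw WithLp.ofLp ((multivariateGaussian 0 S).map WithLp.ofLp)
      (multivariateGaussian 0 S) := ⟨(WithLp.measurable_ofLp 2 _).aemeasurable, rfl⟩
  exact h.fun_comp hY

theorem pi_pi_withDensity_gaussianDensity {a b n : ℕ} (S : Matrix (Fin n) (Fin n) ℝ)
    [IsProbabilityMeasure ((volume : Measure (Fin n → ℝ)).withDensity fun x =>
      ENNReal.ofReal (gaussianDensity x 0 S))] :
    (Measure.pi fun _ : Fin a => Measure.pi fun _ : Fin b =>
      (volume : Measure (Fin n → ℝ)).withDensity fun x =>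
        ENNReal.ofReal (gaussianDensity x 0 S)) =
      (volume : Measure (Fin a → Fin b → Fin n → ℝ)).withDensity fun x =>
        ENNReal.ofReal (∏ p, ∏ i, gaussianDensity (x p i) 0 S) := by
  have hm : Measurable fun x : Fin n → ℝ => ENNReal.ofReal (gaussianDensity x 0 S) :=
    (measurable_gaussianDensity 0 S).ennreal_ofReal
  have h1 := pi_withDensity (n := b) (E := fun _ => Fin n → ℝ) (fun _ => volume)
    (f := fun _ x => ENNReal.ofReal (gaussianDensity x 0 S)) (fun _ => hm)
  -- This supplies the σ-finiteness needed to apply `pi_withDensity` again, to the outer product.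
  have : IsProbabilityMeasure ((Measure.pi fun _ : Fin b => (volume : Measure (Fin n → ℝ))).withDensity
      fun x => ∏ i, ENNReal.ofReal (gaussianDensity (x i) 0 S)) := by
    rw [← h1]; infer_instance
  rw [h1, pi_withDensity (n := a) (E := fun _ => Fin b → Fin n → ℝ)
    (fun _ => Measure.pi fun _ => volume)
    (f := fun _ x => ∏ i, ENNReal.ofReal (gaussianDensity (x i) 0 S)) fun _ =>
      Finset.measurable_prod _ fun i _ => hm.comp (measurable_pi_apply i)]
  congr 1
  ext x
  rw [ENNReal.ofReal_prod_of_nonneg fun p _ =>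
    Finset.prod_nonneg fun i _ => gaussianDensity_nonneg _ _ _]
  exact Finset.prod_congr rfl fun p _ =>
    (ENNReal.ofReal_prod_of_nonneg fun i _ => gaussianDensity_nonneg _ _ _).symm

end LangevinModel

theorem mainTheorem1 {Ω : Type*} [MeasurableSpace Ω] (P : Measure Ω) [IsProbabilityMeasure P]
    (Np d N : ℕ) (γ k : ℝ) (hγ : 0 < γ) (hk : 0 < k) (τ : ℝ≥0) (hτ : 0 < τ)
    (X U W : Fin Np → ℝ≥0 → Ω → EuclideanSpace ℝ (Fin d))
    -- each particle follows the Langevin dynamics driven by a `d`-dimensional Brownian motion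
    (hW : ∀ p, LangevinModel.IsBrownianVector (W p) P)
    (hXU : ∀ p, LangevinModel.IsLangevinSolution γ k (X p) (U p) (W p) P)
    -- the initial velocity has the stationary law and is independent of the Brownian motion
    (hU : ∀ p, HasLaw (U p 0) (multivariateGaussian 0 ((k * γ) • (1 : Matrix (Fin d) (Fin d) ℝ))) P)
    (hUW : ∀ p, IndepFun (U p 0) (fun ω t => W p t ω) P)
    -- the particles are independent
    (hind : iIndepFun (fun p ω => (U p 0 ω, fun t => W p t ω)) P) :
    -- the vectors of successive increments are independent across particles and coordinates
    iIndepFun (fun (q : Fin Np × Fin d) (ω : Ω) (n : Fin N) =>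
        LangevinModel.increment (X q.1) τ q.2 n ω) P ∧
    -- along one coordinate of one particle they are jointly Gaussian with law `N(0, S)`
    (∀ p i, HasLaw (fun ω => WithLp.toLp 2 fun n : Fin N => LangevinModel.increment (X p) τ i n ω)
        (multivariateGaussian 0 (LangevinModel.covMatrix γ k τ N)) P) ∧
    -- `S` is positive definite, and the data have the stated likelihood
    (LangevinModel.covMatrix γ k τ N).PosDef ∧
    HasLaw (fun ω (p : Fin Np) (i : Fin d) (n : Fin N) => LangevinModel.increment (X p) τ i n ω)
      ((volume : Measure (Fin Np → Fin d → Fin N → ℝ)).withDensity fun x =>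
        ENNReal.ofReal (∏ p, ∏ i,
          LangevinModel.gaussianDensity (x p i) 0 (LangevinModel.covMatrix γ k τ N))) P := by
  have hkγ : 0 ≤ k * γ := (mul_pos hk hγ).le
  have hτ' : (0 : ℝ) < τ := hτ
  have hS := LangevinModel.covMatrix_posDef hγ hk hτ' N
  have hlim := fun p i => LangevinModel.ae_tendsto_increment hγ (hW p) (hXU p) τ N i
  have hUm : ∀ p i, Measurable fun ω => U p 0 ω i := fun p i =>
    (EuclideanSpace.proj (𝕜 := ℝ) i).continuous.measurable.comp ((hXU p).measurable_velocity 0)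
  have hWm : ∀ p i, Measurable fun ω (t : ℝ≥0) => W p t ω i := fun p i =>
    measurable_pi_lambda _ fun t =>
      (EuclideanSpace.proj (𝕜 := ℝ) i).continuous.measurable.comp ((hW p).measurable t)
  have hsplit : Measurable fun (x : EuclideanSpace ℝ (Fin d) × (ℝ≥0 → EuclideanSpace ℝ (Fin d)))
      (i : Fin d) => (x.1 i, fun t => x.2 t i) := by fun_prop
  have hcoord : iIndepFun (fun p ω (i : Fin d) => (U p 0 ω i, fun t => W p t ω i)) P :=
    hind.comp (fun _ x i => (x.1 i, fun t => x.2 t i)) fun _ => hsplit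
  -- Within a particle three independences combine: among the velocity coordinates, among the
  -- Brownian coordinates, and between the two families. Independence across particles then extends
  -- this to all pairs `(p, i)`.
  have hpair : ∀ p, iIndepFun (fun (i : Fin d) ω => (U p 0 ω i, fun t => W p t ω i)) P := fun p =>
    iIndepFun.prodMk_of_indepFun (hUm p) (hWm p)
      (LangevinModel.iIndepFun_coord_of_isotropic hkγ (hU p)) (hW p).indep
      ((hUW p).comp (φ := fun (x : EuclideanSpace ℝ (Fin d)) i => x i)
        (ψ := fun (w : ℝ≥0 → EuclideanSpace ℝ (Fin d)) i t => w t i) (by fun_prop) (by fun_prop))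
  have hdata : iIndepFun (fun (q : Fin Np × Fin d) ω => (U q.1 0 ω q.2, fun t => W q.1 t ω q.2))
      P :=
    iIndepFun_uncurry' (X := fun p i ω => (U p 0 ω i, fun t => W p t ω i))
      (fun p i => (hUm p i).prodMk (hWm p i)) hcoord hpair
  -- The upper limit is defined for arbitrary paths and is measurable for the product σ-algebra,
  -- whereas the solution formula makes sense only for suitably regular paths. The same `Φ` serves
  -- every particle and coordinate.
  let Φ : ℝ × (ℝ≥0 → ℝ) → Fin N → ℝ := fun x n =>
    LangevinModel.incrLimit γ (γ * √(2 * k)) τ (N * τ) n x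
  have hΦ : Measurable Φ := measurable_pi_lambda _ fun n => LangevinModel.measurable_incrLimit ..
  have hΦeq : ∀ p i, ∀ᵐ ω ∂P, Φ (U p 0 ω i, fun t => W p t ω i) =
      fun n : Fin N => LangevinModel.increment (X p) τ i n ω := fun p i => by
    filter_upwards [hlim p i] with ω h
    ext n
    exact (h n).limsup_eq
  have hindep : iIndepFun (fun (q : Fin Np × Fin d) (ω : Ω) (n : Fin N) =>
      LangevinModel.increment (X q.1) τ q.2 n ω) P :=
    (hdata.comp (fun _ => Φ) fun _ => hΦ).congr fun q => hΦeq q.1 q.2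
  have hlaw : ∀ p i, HasLaw
      (fun ω => WithLp.toLp 2 fun n : Fin N => LangevinModel.increment (X p) τ i n ω)
      (multivariateGaussian 0 (LangevinModel.covMatrix γ k τ N)) P := fun p i =>
    LangevinModel.hasLaw_of_tendsto_incrApprox ((hW p).isBrownian i).toIsPreBrownianReal hγ hk hτ'
      (LangevinModel.hasLaw_coord_of_isotropic hkγ (hU p) i)
      ((hUW p).comp (φ := fun (x : EuclideanSpace ℝ (Fin d)) => x i)
        (ψ := fun (w : ℝ≥0 → EuclideanSpace ℝ (Fin d)) t => w t i) (by fun_prop) (by fun_prop))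
      (hlim p i)
  refine ⟨hindep, hlaw, hS, ?_⟩
  have hprob : IsProbabilityMeasure ((volume : Measure (Fin N → ℝ)).withDensity fun x =>
      ENNReal.ofReal (LangevinModel.gaussianDensity x 0 (LangevinModel.covMatrix γ k τ N))) := by
    rw [← LangevinModel.map_ofLp_multivariateGaussian hS]
    exact Measure.isProbabilityMeasure_map (WithLp.measurable_ofLp 2 _).aemeasurable
  -- The joint law is a nested product: the outer one uses independence of the whole arrays of the
  -- particles, the inner one uses `hindep` with `p` fixed.
  have hpart : iIndepFun (fun (p : Fin Np) (ω : Ω) (i : Fin d) (n : Fin N) =>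
      LangevinModel.increment (X p) τ i n ω) P :=
    (hcoord.comp (fun _ x i => Φ (x i)) fun _ => by fun_prop).congr fun p => by
      filter_upwards [ae_all_iff.2 (hΦeq p)] with ω h
      exact funext h
  rw [← LangevinModel.pi_pi_withDensity_gaussianDensity]
  exact hpart.hasLaw_pi fun p => (hindep.precomp (Prod.mk_right_injective p)).hasLaw_pi fun i =>
    LangevinModel.hasLaw_gaussianDensity hS (hlaw p i)
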